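/- Let $G$ be a simple complex Lie group with Lie algebra $\mathfrak g$, of one of the types $A_r$ ($r\ge 1$), $B_r$ ($r\ge 2$), $C_r$ ($r\ge 2$), $D_r$ ($r\ge 3$), $E_6,E_7,E_8,F_4,G_2$. Let $\langle\cdot,\cdot\rangle$ be the fundamental quadratic form, i.e. the Weyl-invariant symmetric bilinear form on the weight space for which long roots have square length $2$. Fix a choice of positive roots, let $\rho$ be half their sum, and let $g$ be the dual Coxeter number. For a complex number $q\neq 0$ with $q^2\neq 1$ and a number $x$ put $$[x]_q=\frac{q^{x}-q^{-x}}{q-q^{-1}},\qquad [s]!_q=\prod_{n=1}^{s}[n]_q ,$$ where non-integral powers of $q$ are taken with the principal branch. The quantum Weyl denominator is $$\mathcal D_W=\prod_{\alpha>0}[\langle\rho,\alpha\rangle]_q ,$$ its value at level $k\in\{0,1,2,\dots\}$ being the one at $q=\exp(i\pi/(g+k))$. The quantum Lie superfactorial $\mathrm{sf}_G[q]$ is defined as follows. - If $G$ is simply laced, $\mathrm{sf}_G[q]=\prod_{s\in\mathcal E}[s]!_q$, where $\mathcal E$ is the multiset of exponents of $G$: $\{1,2,\dots,r\}$ for $A_r$;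 $\{1,3,5,\dots,2r-3\}$ together with $r-1$ for $D_r$; $\{1,4,5,7,8,11\}$ for $E_6$; $\{1,5,7,9,11,13,17\}$ for $E_7$; $\{1,7,11,13,17,19,23,29\}$ for $E_8$. - $\mathrm{sf}_{B_r}[q]=\prod_{s=1,3,\dots,2r-1}\left(\left[\tfrac s2\right]_q\,[s-1]_q\,[s-2]_q\cdots[2]_q\,[1]_q\right)$, the factor for $s=1$ being $[\tfrac12]_q$. - $\mathrm{sf}_{C_r}[q]=\prod_{s=3,5,\dots,2r-1}\left(\left[\tfrac{s+1}2\right]_q\prod_{1\le n\le s,\ n\ne (s+1)/2}\left[\tfrac n2\right]_q\right)$ (the factor for $s=1$ being $1$). - $\mathrm{sf}_{F_4}[q]=[\tfrac12]_q^2\,[1]_q^3\,[\tfrac32]_q\,[2]_q^3\,[\tfrac52]_q^2\,[3]_q^3\,[\tfrac72]_q\,[4]_q^2\,[\tfrac92]_q\,[5]_q^2\,[\tfrac{11}2]_q\,[6]_q\,[7]_q\,[8]_q$. - $\mathrm{sf}_{G_2}[q]=[\tfrac53]_q\,[\tfrac43]_q\,[3]_q\,[2]_q\,[1]_q\,[\tfrac13]_q$.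 **Theorem.** The quantum Weyl denominator of $G$ equals the quantum Lie superfactorial of type $G$: $\mathcal D_W=\mathrm{sf}_G[q]$. This holds at every level $k\ge 0$, with $q=\exp(i\pi/(g+k))$, and more generally for every complex $q\ne 0$ with $q^2\ne 1$. -/

import Mathlib

/-! Quantum numbers, simple Lie types, quantum Lie superfactorials and quantum Weyl denominators. -/

noncomputable section

/-- The `q`-number `[x]_q = (q^x - q^(-x)) / (q - q^(-1))`; non-integral powers of `q` are taken
with the principal branch. -/
def qNumber (q x : ℂ) : ℂ := (q ^ x - q ^ (-x)) / (q - q⁻¹)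

/-- The quantum factorial `[s]!_q = [1]_q [2]_q ⋯ [s]_q`. -/
def qFactorial (q : ℂ) (s : ℕ) : ℂ := ∏ n ∈ Finset.Icc 1 s, qNumber q n

/-- The modified quantum factorial of type `B`: `[s/2]_q [s-1]_q [s-2]_q ⋯ [2]_q [1]_q`
(equal to `[1/2]_q` for `s = 1`). -/
def qFactorialB (q : ℂ) (s : ℕ) : ℂ :=
  qNumber q ((s : ℂ) / 2) * ∏ n ∈ Finset.Icc 1 (s - 1), qNumber q n

/-- The modified quantum factorial of type `C`, for odd `s`: it is `1` for `s = 1`, and otherwise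
it is the product of the `[n/2]_q`, `1 ≤ n ≤ s`, in which the middle factor, `n = (s+1)/2`, is
replaced by `[n]_q`. -/
def qFactorialC (q : ℂ) (s : ℕ) : ℂ :=
  if s = 1 then 1
  else ∏ n ∈ Finset.Icc 1 s,
    if n = (s + 1) / 2 then qNumber q n else qNumber q ((n : ℂ) / 2)

/-- The types of simple complex Lie algebras (or Lie groups), indexed by their rank. -/
inductive SimpleLieType : Type
  | A (r : ℕ) (hr : 1 ≤ r)
  | B (r : ℕ) (hr : 2 ≤ r)
  | C (r : ℕ) (hr : 2 ≤ r)
  | D (r : ℕ) (hr : 3 ≤ r)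
  | E6
  | E7
  | E8
  | F4
  | G2

namespace SimpleLieType

/-- The rank. -/
def rank : SimpleLieType → ℕ
  | A r _ => r
  | B r _ => r
  | C r _ => r
  | D r _ => r
  | E6 => 6
  | E7 => 7
  | E8 => 8
  | F4 => 4
  | G2 => 2

/-- The Cartan matrix, with `(i, j)` entry `2 (α_i, α_j) / (α_j, α_j)`. -/
def cartanMatrix : (G : SimpleLieType) → Matrix (Fin G.rank) (Fin G.rank) ℤ
  | A r _ => CartanMatrix.A r
  | B r _ => CartanMatrix.B r
  | C r _ => CartanMatrix.C r
  | D r _ => CartanMatrix.D r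
  | E6 => CartanMatrix.E₆
  | E7 => CartanMatrix.E₇
  | E8 => CartanMatrix.E₈
  | F4 => CartanMatrix.F₄
  | G2 => CartanMatrix.G₂

/-- The multiset of exponents. -/
def exponents : SimpleLieType → Multiset ℕ
  | A r _ => (Multiset.range r).map fun i => i + 1
  | B r _ => (Multiset.range r).map fun i => 2 * i + 1
  | C r _ => (Multiset.range r).map fun i => 2 * i + 1
  | D r _ => (r - 1) ::ₘ (Multiset.range (r - 1)).map fun i => 2 * i + 1
  | E6 => {1, 4, 5, 7, 8, 11}
  | E7 => {1, 5, 7, 9, 11, 13, 17}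
  | E8 => {1, 7, 11, 13, 17, 19, 23, 29}
  | F4 => {1, 5, 7, 11}
  | G2 => {1, 5}

/-- The quantum Lie superfactorial `sf_G[q]`. -/
def superfactorial (G : SimpleLieType) (q : ℂ) : ℂ :=
  match G with
  | B _ _ => (G.exponents.map (qFactorialB q)).prod
  | C _ _ => (G.exponents.map (qFactorialC q)).prod
  | F4 =>
      qNumber q (1 / 2) ^ 2 * qNumber q 1 ^ 3 * qNumber q (3 / 2) * qNumber q 2 ^ 3 *
      qNumber q (5 / 2) ^ 2 * qNumber q 3 ^ 3 * qNumber q (7 / 2) * qNumber q 4 ^ 2 *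
      qNumber q (9 / 2) * qNumber q 5 ^ 2 * qNumber q (11 / 2) * qNumber q 6 * qNumber q 7 *
      qNumber q 8
  | G2 =>
      qNumber q (5 / 3) * qNumber q (4 / 3) * qNumber q 3 * qNumber q 2 * qNumber q 1 *
      qNumber q (1 / 3)
  | _ => (G.exponents.map (qFactorial q)).prod

end SimpleLieType

section RootSystem

variable {ι M N : Type*} [Fintype ι] [AddCommGroup M] [Module ℂ M] [AddCommGroup N] [Module ℂ N]
  {P : RootPairing ι ℂ M N} [P.IsCrystallographic]

/-- The root system, with simple roots given by the base `b`, is of type `G`: its Cartan matrix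
is that of `G`, up to a numbering of the simple roots. -/
def HasLieType (b : P.Base) (G : SimpleLieType) : Prop :=
  ∃ e : b.support ≃ Fin G.rank, ∀ i j, b.cartanMatrix i j = G.cartanMatrix (e i) (e j)

variable (P) in
/-- The fundamental quadratic form of an irreducible root system: the Weyl-invariant symmetric
bilinear form on the weight space for which the long roots have square length `2`. It is
obtained by rescaling the canonical invariant form `∑ α, ⟨x, α^∨⟩ ⟨y, α^∨⟩`, which takes
positive integral values on the pairs `(α, α)`. -/
def fundamentalForm : LinearMap.BilinForm ℂ M :=
  (2 / ((⨆ i, (P.posRootForm ℤ).rootLength i : ℤ) : ℂ)) • P.RootForm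

open Classical in
/-- The set of positive roots (given by their indices). -/
def positiveRoots (b : P.Base) : Finset ι := {i | b.IsPos i}

/-- The Weyl vector: half the sum of the positive roots. -/
def weylVector (b : P.Base) : M := (1 / 2 : ℂ) • ∑ i ∈ positiveRoots b, P.root i

/-- The quantum Weyl denominator `∏_{α > 0} [⟨ρ, α⟩]_q`. -/
def quantumWeylDenominator (b : P.Base) (q : ℂ) : ℂ :=
  ∏ i ∈ positiveRoots b, qNumber q (fundamentalForm P (weylVector b) (P.root i))

/-- `θ` is the highest root. -/
def IsHighestRoot (b : P.Base) (θ : ι) : Prop := ∀ i, b.height i ≤ b.height θ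

/-- The dual Coxeter number `1 + ∑ (dual Kac labels)`: one plus the height of the coroot of the
highest root `θ` with respect to the simple coroots. -/
def dualCoxeterNumber (b : P.Base) (θ : ι) : ℤ := 1 + b.flip.height θ

/-- The value `q = exp(iπ / (g + k))` at level `k`, where `g` is the dual Coxeter number. -/
def levelParameter (g : ℤ) (k : ℕ) : ℂ := Complex.exp (Complex.I * Real.pi / ((g : ℂ) + (k : ℂ)))

end RootSystem

end

/-! The Weyl vector satisfies `⟨ρ, α_j^∨⟩ = 1` on simple coroots, because the simple reflection
`s_j` permutes the positive roots other than `α_j`. Hence `⟨ρ, α_j⟩` is half the square length of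
`α_j`, that is `d_j / d_max` for any symmetrizer `d` of the Cartan matrix
(`fundamentalForm_weylVector_simple`). The denominator thus depends only on the coordinates of the
positive roots on the simple roots.

`quantumWeylDenominator_eq_prod` makes this usable: the linear map sending simple roots to model
vectors identifies the positive roots with any finite set that is closed under, and generated by,
simple reflections in the appropriate sense.

For the exceptional types the model is a finite table verified by the kernel. For the classical
types it is the usual set of vectors `ε_b ± ε_a`, with multiples of `ε_b` for `B` and `C`. Grouping
roots by their larger index `b` turns the product into factorial-like blocks; for `A`, `B`, `C` each
block is one factor of the superfactorial, and for `D` one extra q-number per block assembles into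
the factorial of the exponent `r - 1`. -/

noncomputable section

open Finset

/-! ### The Weyl vector, and comparison of the positive roots with a model -/

namespace RootPairing.Base

variable {ι M N : Type*} [Fintype ι] [AddCommGroup M] [Module ℂ M] [AddCommGroup N] [Module ℂ N]
  {P : RootPairing ι ℂ M N} [P.IsCrystallographic]

omit [P.IsCrystallographic] in
lemma mem_positiveRoots {b : P.Base} {i : ι} : i ∈ positiveRoots b ↔ b.IsPos i := by
  simp [positiveRoots]

omit [Fintype ι] [P.IsCrystallographic] in
lemma not_isPos_reflectionPerm_self {b : P.Base} {i : ι} (hi : b.IsPos i) :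
    ¬ b.IsPos (P.reflectionPerm i i) :=
  letI := P.indexNeg
  fun h ↦ (IsPos.neg_iff_not b i).1 h hi

section Reduced

variable [P.IsReduced]

/-- The sum of the positive roots pairs to `2` with every simple coroot. -/
lemma sum_positiveRoots_pairing (b : P.Base) {j : ι} (hj : j ∈ b.support) :
    ∑ i ∈ positiveRoots b, P.pairing i j = 2 := by
  classical
  have hpos : j ∈ positiveRoots b := mem_positiveRoots.2 (isPos_of_mem_support hj)
  rw [← Finset.add_sum_erase _ _ hpos, P.pairing_same, add_eq_left]
  -- `s_j` permutes the positive roots other than `α_j` and negates their pairing with `α_j^∨`, so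
  -- these terms cancel and only `⟨α_j, α_j^∨⟩ = 2` survives.
  refine Finset.sum_involution (fun i _ ↦ P.reflectionPerm j i) ?_ ?_ ?_ ?_
  · intro i _
    rw [← pairing_reflectionPerm, pairing_reflectionPerm_self_right, add_neg_cancel]
  · intro i _ h0 h
    apply h0
    have h1 : P.pairing (P.reflectionPerm j i) j = -P.pairing i j := by
      rw [← pairing_reflectionPerm, pairing_reflectionPerm_self_right]
    rw [h] at h1
    linear_combination h1 / 2
  · intro i hi
    obtain ⟨hij, hi⟩ := Finset.mem_erase.1 hi
    have hi := mem_positiveRoots.1 hi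
    refine Finset.mem_erase.2 ⟨fun h ↦ ?_, mem_positiveRoots.2 (hi.reflectionPerm hj hij)⟩
    have : i = P.reflectionPerm j j := by
      rw [← P.reflectionPerm_self j i, h]
    exact not_isPos_reflectionPerm_self (isPos_of_mem_support hj) (this ▸ hi)
  · intro i _
    exact P.reflectionPerm_self j i

/-- Every root has the same length as a simple root. -/
lemma exists_rootLength_eq (b : P.Base) (i : ι) :
    ∃ j ∈ b.support, (P.posRootForm ℤ).rootLength i = (P.posRootForm ℤ).rootLength j := by
  have key (i j : ι) : (P.posRootForm ℤ).rootLength (P.reflectionPerm j i) =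
      (P.posRootForm ℤ).rootLength i := by
    apply FaithfulSMul.algebraMap_injective ℤ ℂ
    rw [RootPositiveForm.algebraMap_rootLength, RootPositiveForm.algebraMap_rootLength,
      root_reflectionPerm]
    exact (P.posRootForm ℤ).isOrthogonal_reflection j _ _
  refine b.induction_reflect i (p := fun i ↦ ∃ j ∈ b.support, (P.posRootForm ℤ).rootLength i =
    (P.posRootForm ℤ).rootLength j) ?_ (fun i hi ↦ ⟨i, hi, rfl⟩) ?_
  · rintro i ⟨j, hj, h⟩
    exact ⟨j, hj, by rw [key, h]⟩
  · rintro i k ⟨j, hj, h⟩ -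
    exact ⟨j, hj, by rw [key, h]⟩

lemma fundamentalForm_weylVector_root (b : P.Base) {j : ι} (hj : j ∈ b.support) :
    fundamentalForm P (weylVector b) (P.root j) =
      (P.posRootForm ℤ).rootLength j / ((⨆ i, (P.posRootForm ℤ).rootLength i : ℤ) : ℂ) := by
  have h1 (i : ι) : P.RootForm (P.root i) (P.root j) =
      P.pairing i j * ((P.posRootForm ℤ).rootLength j : ℂ) / 2 := by
    have := (P.posRootForm ℤ).two_mul_apply_root_root i j
    rw [← RootPositiveForm.algebraMap_rootLength] at this
    change 2 * P.RootForm (P.root i) (P.root j) = P.pairing i j * _ at this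
    rw [eq_div_iff two_ne_zero, mul_comm]
    exact this
  simp only [fundamentalForm, weylVector, LinearMap.smul_apply, map_smul, map_sum,
    LinearMap.sum_apply, h1, smul_eq_mul]
  rw [← Finset.mul_sum, ← Finset.sum_div, ← Finset.sum_mul, b.sum_positiveRoots_pairing hj]
  ring

end Reduced

section Irreducible

variable [P.IsReduced] [P.IsRootSystem] [P.IsIrreducible] {n : ℕ}
  {A : Matrix (Fin n) (Fin n) ℤ} {b : P.Base} (e : b.support ≃ Fin n)
  (he : ∀ i j, b.cartanMatrix i j = A (e i) (e j))

omit [P.IsRootSystem] in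
include he in
/-- The values of the Weyl vector on the simple roots, in terms of a symmetrizer of the Cartan
matrix with largest entry `d k`. -/
lemma fundamentalForm_weylVector_simple (d : Fin n → ℕ) (hd : ∀ i, 0 < d i)
    (hA : ∀ i j, A i j * d j = A j i * d i) {k : Fin n} (hk : ∀ i, d i ≤ d k) (j : Fin n) :
    fundamentalForm P (weylVector b) (P.root (e.symm j)) = (d j : ℂ) / d k := by
  set l := (P.posRootForm ℤ).rootLength with hl
  have hpos (i : ι) : 0 < l i := (P.posRootForm ℤ).rootLength_pos i
  -- Square lengths and `d` both symmetrize the Cartan matrix. By irreducibility the Dynkin diagram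
  -- is connected, so their ratio propagates from node `k` to all nodes.
  have key (i : b.support) : l (e.symm k) * d (e i) = l i * d k := by
    refine b.induction_on_cartanMatrix (fun i ↦ l (e.symm k) * d (e i) = l i * d k)
      (i := e.symm k) (by simp) ?_
    intro i j hi hji
    have hij : b.cartanMatrix i j ≠ 0 := fun h ↦ hji (b.cartanMatrix_apply_eq_zero_iff_symm.1 h)
    have h1 : b.cartanMatrix j i * l i = b.cartanMatrix i j * l j :=
      (P.posRootForm ℤ).pairingIn_mul_eq_pairingIn_mul_swap i j
    have h2 := hA (e i) (e j)
    rw [← he, ← he] at h2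
    apply mul_left_cancel₀ hij
    linear_combination l (e.symm k) * h2 + b.cartanMatrix j i * hi + (d k : ℤ) * h1
  -- The supremum runs over all roots, but every length already occurs among simple roots.
  have hmax : (⨆ i, l i) = l (e.symm k) := by
    have : Nonempty ι := ⟨e.symm k⟩
    refine le_antisymm (ciSup_le fun i ↦ ?_) (le_ciSup (Set.finite_range l).bddAbove _)
    obtain ⟨j, hj, hij⟩ := b.exists_rootLength_eq i
    rw [hl, hij, ← hl]
    have h1 := key ⟨j, hj⟩
    have h2 : (d (e ⟨j, hj⟩) : ℤ) ≤ d k := by exact_mod_cast hk _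
    have h3 : (0 : ℤ) < d k := by exact_mod_cast hd k
    refine le_of_mul_le_mul_right ?_ h3
    calc l j * d k = l (e.symm k) * d (e ⟨j, hj⟩) := h1.symm
      _ ≤ l (e.symm k) * d k := mul_le_mul_of_nonneg_left h2 (hpos _).le
  rw [b.fundamentalForm_weylVector_root (e.symm j).2, ← hl, hmax]
  have h1 := key (e.symm j)
  rw [e.apply_symm_apply] at h1
  have h2 : (l (e.symm k) : ℂ) ≠ 0 := by exact_mod_cast (hpos _).ne'
  have h3 : (d k : ℂ) ≠ 0 := by exact_mod_cast (hd k).ne'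
  rw [div_eq_div_iff h2 h3, mul_comm (d j : ℂ)]
  exact_mod_cast h1.symm

include he in
/-- A finite set of vectors which contains vectors `v i` playing the role of the simple roots,
which is stable under the simple reflections (apart from the reflection of `v i` in itself), and
which is generated from the `v i` by simple reflections, is a model of the positive roots. -/
theorem quantumWeylDenominator_eq_prod {V : Type*} [AddCommGroup V] [Module ℂ V]
    (d : Fin n → ℕ) (hd : ∀ i, 0 < d i)
    (hA : ∀ i j, A i j * d j = A j i * d i) {k : Fin n} (hk : ∀ i, d i ≤ d k)
    (v : Fin n → V) (w : Fin n → Module.Dual ℂ V) (hwv : ∀ i j, w j (v i) = A i j)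
    (S : Finset V) (hv : ∀ i, v i ∈ S)
    (hS : ∀ i, ∀ x ∈ S, x ≠ v i → x - w i x • v i ∈ S)
    (hgen : ∀ p : V → Prop, (∀ i, p (v i)) →
      (∀ i, ∀ x ∈ S, x ≠ v i → p x → p (x - w i x • v i)) → ∀ x ∈ S, p x)
    (h : Module.Dual ℂ V) (hh : ∀ i, h (v i) = (d i : ℂ) / d k) (q : ℂ) :
    quantumWeylDenominator b q = ∏ x ∈ S, qNumber q (h x) := by
  classical
  let φ : M →ₗ[ℂ] V := b.toWeightBasis.constr ℂ (fun i ↦ v (e i))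
  have hφ (i : b.support) : φ (P.root i) = v (e i) := by
    have := b.toWeightBasis.constr_basis ℂ (fun i ↦ v (e i)) i
    rwa [b.toWeightBasis_apply] at this
  have hw (j : b.support) (x : M) : w (e j) (φ x) = P.coroot' j x := by
    suffices (w (e j)).comp φ = P.coroot' j from LinearMap.congr_fun this x
    refine b.toWeightBasis.ext fun i ↦ ?_
    rw [b.toWeightBasis_apply, LinearMap.comp_apply, hφ, hwv, ← he, root_coroot'_eq_pairing]
    exact b.algebraMap_cartanMatrixIn_apply ℤ i j
  have hrefl (i : ι) (j : b.support) : φ (P.root (P.reflectionPerm j i)) =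
      φ (P.root i) - w (e j) (φ (P.root i)) • v (e j) := by
    rw [root_reflectionPerm, reflection_apply, map_sub, map_smul, hφ, hw]
  -- The `v i` are not assumed independent: a vector killed by `φ` is killed by every simple coroot,
  -- hence is zero by perfectness of the pairing.
  have hinj : Function.Injective φ := by
    rw [injective_iff_map_eq_zero]
    intro x hx
    have h1 (j : b.support) : P.coroot' j x = 0 := by rw [← hw, hx, map_zero]
    have h2 : P.toLinearMap x = 0 := b.toCoweightBasis.ext fun j ↦ by
      rw [b.toCoweightBasis_apply]
      exact h1 j
    exact (LinearMap.IsPerfPair.bijective_left P.toLinearMap).1 (h2.trans (map_zero _).symm)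
  have hmem (i : ι) (hi : b.IsPos i) : φ (P.root i) ∈ S := by
    -- The motive is conditional on positivity because the induction says nothing about the sign of
    -- intermediate roots. Unless the reflected root is `α_j` itself, its positivity passes back to
    -- `i`.
    refine hi.induction_on_reflect (p := fun i ↦ b.IsPos i → φ (P.root i) ∈ S)
      (fun i h _ ↦ by rw [hφ ⟨i, h⟩]; exact hv _) ?_ hi
    intro i j hi hj hpos
    by_cases hij : P.reflectionPerm j i = j
    · rw [hij, hφ ⟨j, hj⟩]
      exact hv _
    have hi' : b.IsPos i := by simpa using hpos.reflectionPerm hj hij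
    rw [hrefl i ⟨j, hj⟩]
    refine hS _ _ (hi hi') fun h ↦ ?_
    rw [← hφ ⟨j, hj⟩] at h
    have h := P.root.injective (hinj h)
    subst h
    exact not_isPos_reflectionPerm_self hi' hpos
  have hsurj (x : V) (hx : x ∈ S) : ∃ i, b.IsPos i ∧ φ (P.root i) = x := by
    refine hgen (fun x ↦ ∃ i, b.IsPos i ∧ φ (P.root i) = x) (fun i ↦ ?_) ?_ x hx
    · exact ⟨e.symm i, isPos_of_mem_support (e.symm i).2, by rw [hφ, e.apply_symm_apply]⟩
    · rintro j _ - hij ⟨i, hi, rfl⟩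
      have h1 := hrefl i (e.symm j)
      rw [e.apply_symm_apply] at h1
      refine ⟨_, hi.reflectionPerm (e.symm j).2 fun h ↦ hij ?_, h1⟩
      rw [h, hφ, e.apply_symm_apply]
  have hF (x : M) : fundamentalForm P (weylVector b) x = h (φ x) := by
    suffices fundamentalForm P (weylVector b) = h.comp φ from LinearMap.congr_fun this x
    refine b.toWeightBasis.ext fun i ↦ ?_
    rw [b.toWeightBasis_apply, LinearMap.comp_apply, hφ, hh]
    simpa using fundamentalForm_weylVector_simple e he d hd hA hk (e i)
  refine Finset.prod_bij (fun i _ ↦ φ (P.root i)) ?_ ?_ ?_ ?_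
  · exact fun i hi ↦ hmem i (mem_positiveRoots.1 hi)
  · exact fun i _ j _ hij ↦ P.root.injective (hinj hij)
  · intro x hx
    obtain ⟨i, hi, rfl⟩ := hsurj x hx
    exact ⟨i, mem_positiveRoots.2 hi, rfl⟩
  · exact fun i _ ↦ by rw [hF]

end Irreducible

end RootPairing.Base

/-! ### Root tables encoded by decimal digits -/

/-- The `i`-th decimal digit. -/
def decimalDigit (x i : ℕ) : ℕ := x / 10 ^ i % 10

/-- The pairing with the `i`-th simple coroot of the vector whose coordinates on the simple roots
are the digits of `x`. -/
def digitPairing {n : ℕ} (A : Matrix (Fin n) (Fin n) ℤ) (i : Fin n) (x : ℕ) : ℤ :=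
  ∑ l, A l i * decimalDigit x l

/-- The `i`-th simple reflection, on vectors encoded by their digits. -/
def digitReflection {n : ℕ} (A : Matrix (Fin n) (Fin n) ℤ) (i : Fin n) (x : ℕ) : ℕ :=
  (x - digitPairing A i x * 10 ^ (i : ℕ) : ℤ).toNat

/-- `L` lists the positive roots of the root system with Cartan matrix `A`: the digits of the
elements of `L` are the coordinates of the roots on the simple roots, the list contains the
simple roots, is stable under the simple reflections, and all its elements can be reflected down
to the simple roots. -/
def IsRootTable {n : ℕ} (A : Matrix (Fin n) (Fin n) ℤ) (L : List ℕ) : Prop :=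
  L.Nodup ∧ (∀ i : Fin n, 10 ^ (i : ℕ) ∈ L) ∧ (∀ i j : Fin n, decimalDigit (10 ^ (i : ℕ)) j =
    if i = j then 1 else 0) ∧ ∀ x ∈ L,
      x = ∑ i : Fin n, decimalDigit x i * 10 ^ (i : ℕ) ∧
      -- The digit identity rules out borrowing and truncation by `toNat`, so the integer operation
      -- is the true reflection.
      (∀ i : Fin n, x = 10 ^ (i : ℕ) ∨ (digitReflection A i x ∈ L ∧ ∀ k : Fin n,
        (decimalDigit (digitReflection A i x) k : ℤ) =
          decimalDigit x k - if i = k then digitPairing A i x else 0)) ∧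
      ((∃ i : Fin n, x = 10 ^ (i : ℕ)) ∨ ∃ i : Fin n, digitReflection A i x < x ∧
        digitReflection A i x ∈ L ∧
        digitReflection A i x ≠ 10 ^ (i : ℕ) ∧ digitReflection A i (digitReflection A i x) = x)

instance {n : ℕ} (A : Matrix (Fin n) (Fin n) ℤ) (L : List ℕ) : Decidable (IsRootTable A L) := by
  unfold IsRootTable
  infer_instance

/-- Leaves only decidable conditions on the Cartan matrix and the table. The entries of `T` are the
values `⟨ρ, α⟩` multiplied by `d k`. -/
theorem quantumWeylDenominator_eq_of_isRootTable
    {ι M N : Type*} [Fintype ι] [AddCommGroup M] [Module ℂ M] [AddCommGroup N] [Module ℂ N]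
    {P : RootPairing ι ℂ M N} [P.IsCrystallographic]
    [P.IsReduced] [P.IsRootSystem] [P.IsIrreducible] {n : ℕ}
    {A : Matrix (Fin n) (Fin n) ℤ} {b : P.Base} (e : b.support ≃ Fin n)
    (he : ∀ i j, b.cartanMatrix i j = A (e i) (e j))
    (d : Fin n → ℕ) (hd : ∀ i, 0 < d i)
    (hA : ∀ i j, A i j * d j = A j i * d i) {k : Fin n} (hk : ∀ i, d i ≤ d k)
    {L : List ℕ} (hL : IsRootTable A L) {T : Multiset ℕ}
    (hT : (L : Multiset ℕ).map (fun x ↦ ∑ i, d i * decimalDigit x i) = T) (q : ℂ) :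
    quantumWeylDenominator b q = (T.map fun t : ℕ ↦ qNumber q ((t : ℂ) / d k)).prod := by
  classical
  obtain ⟨hnodup, hsimple, hdig, hL⟩ := hL
  let f (x : ℕ) : Fin n → ℂ := fun i ↦ (decimalDigit x i : ℂ)
  have hf : Set.InjOn f L.toFinset := by
    intro x hx y hy hxy
    rw [(hL x (by simpa using hx)).1, (hL y (by simpa using hy)).1]
    refine Finset.sum_congr rfl fun i _ ↦ ?_
    have : (decimalDigit x i : ℂ) = decimalDigit y i := congrFun hxy i
    rw [Nat.cast_inj.1 this]
  let w (j : Fin n) : Module.Dual ℂ (Fin n → ℂ) := ∑ l, (A l j : ℂ) • LinearMap.proj l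
  have hw (j : Fin n) (x : ℕ) : w j (f x) = digitPairing A j x := by
    simp [w, f, digitPairing]
  have hv (i : Fin n) : f (10 ^ (i : ℕ)) = Pi.single i 1 := by
    ext j
    simp [f, hdig, Pi.single_apply, eq_comm]
  have hrefl (i : Fin n) (x : ℕ) (hx : x ∈ L) (hxi : x ≠ 10 ^ (i : ℕ)) :
      digitReflection A i x ∈ L ∧
        f (digitReflection A i x) = f x - w i (f x) • f (10 ^ (i : ℕ)) := by
    obtain ⟨h1, h2⟩ := ((hL x hx).2.1 i).resolve_left hxi
    refine ⟨h1, ?_⟩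
    ext k
    rw [hw, hv]
    have h3 : ((decimalDigit (digitReflection A i x) k : ℤ) : ℂ) = _ := congrArg _ (h2 k)
    push_cast at h3
    simp [f, h3, Pi.single_apply, eq_comm]
  rw [RootPairing.Base.quantumWeylDenominator_eq_prod e he d hd hA hk (fun i ↦ f (10 ^ (i : ℕ))) w
    ?_ (L.toFinset.image f) ?_ ?_ ?_ (∑ l, ((d l : ℂ) / d k) • LinearMap.proj l) ?_ q]
  · rw [Finset.prod_image hf, ← hT, Multiset.map_map, Finset.prod, List.toFinset_val,
      hnodup.dedup]
    congr 1
    refine Multiset.map_congr rfl fun x _ ↦ ?_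
    simp [f, Finset.sum_div, div_mul_eq_mul_div]
  · intro i j
    simp [hv, w, Pi.single_apply]
  · exact fun i ↦ Finset.mem_image_of_mem _ (by simpa using hsimple i)
  · intro i x hx hxi
    obtain ⟨x, hxL, rfl⟩ := Finset.mem_image.1 hx
    obtain ⟨h1, h2⟩ := hrefl i x (by simpa using hxL) fun h ↦ hxi (by rw [h])
    rw [← h2]
    exact Finset.mem_image_of_mem _ (by simpa using h1)
  · intro p h1 h2 x hx
    obtain ⟨x, hxL, rfl⟩ := Finset.mem_image.1 hx
    rw [List.mem_toFinset] at hxL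
    clear hx
    -- A non-simple code reflects to a smaller one in the table, and the same reflection leads back
    -- up to `x`.
    induction x using Nat.strong_induction_on with
    | _ x ih =>
      obtain ⟨i, rfl⟩ | ⟨i, hlt, hmem, hne, hinv⟩ := (hL x hxL).2.2
      · exact h1 i
      · have h3 := (hrefl i _ hmem hne).2
        rw [hinv] at h3
        rw [h3]
        refine h2 i _ (Finset.mem_image_of_mem _ (by simpa using hmem)) (fun h ↦ hne ?_)
          (ih _ hlt hmem)
        exact hf (by simpa using hmem) (by simpa using hsimple i) h
  · intro i
    simp [hv, Pi.single_apply]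

/-- A product of quantum factorials, as a product of `q`-numbers. -/
lemma prod_map_qFactorial (q : ℂ) (E : Multiset ℕ) :
    (E.map (qFactorial q)).prod =
      ((E.bind fun s ↦ (Finset.Icc 1 s).val).map fun t : ℕ ↦ qNumber q t).prod := by
  rw [Multiset.map_bind, Multiset.prod_bind]
  rfl

/-! ### Exceptional types -/

/-- The positive roots of `E₈`. -/
def rootTableE8 : List ℕ := [
    10000000, 1000000, 100000, 10000, 1000, 100, 10, 1, 11000000, 1100000, 110000, 11000, 1100,
    1010, 101, 11100000, 1110000, 111000, 11100, 11010, 1110, 1101, 11110000, 1111000, 111100,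
    111010, 11110, 11101, 1111, 11111000, 1111100, 1111010, 111110, 12110, 111101, 11111,
    11111100, 11111010, 1111110, 112110, 1111101, 111111, 12111, 11111110, 1112110, 122110,
    11111101, 1111111, 112111, 12211, 11112110, 1122110, 11111111, 1112111, 122111, 112211,
    11122110, 1222110, 11112111, 1122111, 1112211, 122211, 11222110, 11122111, 1222111,
    11112211, 1122211, 123211, 12222110, 11222111, 11122211, 1222211, 1123211, 123221, 12222111,
    11222211, 11123211, 1223211, 1123221, 12222211, 11223211, 1233211, 11123221, 1223221,
    12223211, 11233211, 11223221, 1233221, 12233211, 12223221, 11233221, 1234221, 12333211,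
    12233221, 11234221, 1234321, 12333221, 12234221, 11234321, 1234322, 12334221, 12234321,
    11234322, 12344221, 12334321, 12234322, 12344321, 12334322, 12345321, 12344322, 12345331,
    12345322, 12345422, 12345332, 12345432, 12346432, 12356432, 12456432, 13456432, 23456432]

/-- The positive roots of `F₄`. -/
def rootTableF4 : List ℕ := [
    1000, 100, 10, 1, 1100, 110, 11, 1110, 210, 111, 1210, 1111, 211, 2210, 1211, 221, 2211,
    1221, 2221, 1321, 2321, 2421, 2431, 2432]

/-- The positive roots of `G₂`. -/
def rootTableG2 : List ℕ := [10, 1, 11, 21, 31, 32]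

lemma isRootTable_E8 : IsRootTable CartanMatrix.E₈ rootTableE8 := by
  decide +kernel

/-- Codes below `10 ^ 7` are the roots of `E₈` without component on the last simple root; these form
the subsystem `E₇`. -/
lemma isRootTable_E7 : IsRootTable CartanMatrix.E₇ (rootTableE8.filter (· < 10 ^ 7)) := by
  decide +kernel

lemma isRootTable_E6 : IsRootTable CartanMatrix.E₆ (rootTableE8.filter (· < 10 ^ 6)) := by
  decide +kernel

lemma isRootTable_F4 : IsRootTable CartanMatrix.F₄ rootTableF4 := by
  decide +kernel

lemma isRootTable_G2 : IsRootTable CartanMatrix.G₂ rootTableG2 := by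
  decide +kernel

section Exceptional

variable {ι M N : Type*} [Fintype ι] [AddCommGroup M] [Module ℂ M] [AddCommGroup N] [Module ℂ N]
  {P : RootPairing ι ℂ M N} [P.IsCrystallographic] [P.IsReduced] [P.IsRootSystem]
  [P.IsIrreducible] {b : P.Base} (q : ℂ)

/-- Here `⟨ρ, α⟩` is the height, and the number of positive roots of height `m` is the number of
exponents at least `m`. This duality, which says that the heights fill the intervals `[1, s]`, is
read off the table. -/
lemma quantumWeylDenominator_E6 (h : HasLieType b .E6) :
    quantumWeylDenominator b q = SimpleLieType.E6.superfactorial q := by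
  obtain ⟨e, he⟩ := h
  rw [quantumWeylDenominator_eq_of_isRootTable (A := CartanMatrix.E₆) e he (fun _ ↦ 1) (by simp)
    (by decide +kernel) (k := 0) (by simp) isRootTable_E6
    (T := SimpleLieType.E6.exponents.bind fun s ↦ (Finset.Icc 1 s).val) (by decide +kernel)]
  simp [SimpleLieType.superfactorial, prod_map_qFactorial]

lemma quantumWeylDenominator_E7 (h : HasLieType b .E7) :
    quantumWeylDenominator b q = SimpleLieType.E7.superfactorial q := by
  obtain ⟨e, he⟩ := h
  rw [quantumWeylDenominator_eq_of_isRootTable (A := CartanMatrix.E₇) e he (fun _ ↦ 1) (by simp)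
    (by decide +kernel) (k := 0) (by simp) isRootTable_E7
    (T := SimpleLieType.E7.exponents.bind fun s ↦ (Finset.Icc 1 s).val) (by decide +kernel)]
  simp [SimpleLieType.superfactorial, prod_map_qFactorial]

lemma quantumWeylDenominator_E8 (h : HasLieType b .E8) :
    quantumWeylDenominator b q = SimpleLieType.E8.superfactorial q := by
  obtain ⟨e, he⟩ := h
  rw [quantumWeylDenominator_eq_of_isRootTable (A := CartanMatrix.E₈) e he (fun _ ↦ 1) (by simp)
    (by decide +kernel) (k := 0) (by simp) isRootTable_E8
    (T := SimpleLieType.E8.exponents.bind fun s ↦ (Finset.Icc 1 s).val) (by decide +kernel)]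
  simp [SimpleLieType.superfactorial, prod_map_qFactorial]

lemma quantumWeylDenominator_F4 (h : HasLieType b .F4) :
    quantumWeylDenominator b q = SimpleLieType.F4.superfactorial q := by
  obtain ⟨e, he⟩ := h
  -- The first two simple roots are long, and `T` lists the numbers `2⟨ρ, α⟩`.
  rw [quantumWeylDenominator_eq_of_isRootTable (A := CartanMatrix.F₄) e he ![2, 2, 1, 1]
    (by decide) (by decide +kernel) (k := 0) (by decide) isRootTable_F4
    (T := {1, 1, 2, 2, 2, 3, 4, 4, 4, 5, 5, 6, 6, 6, 7, 8, 8, 9, 10, 10, 11, 12, 14, 16})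
    (by decide +kernel)]
  simp only [SimpleLieType.superfactorial, Multiset.insert_eq_cons, Multiset.map_cons,
    Multiset.prod_cons, Multiset.map_singleton, Multiset.prod_singleton]
  norm_num
  ring

lemma quantumWeylDenominator_G2 (h : HasLieType b .G2) :
    quantumWeylDenominator b q = SimpleLieType.G2.superfactorial q := by
  obtain ⟨e, he⟩ := h
  -- The first simple root is long, and `T` lists the numbers `3⟨ρ, α⟩`.
  rw [quantumWeylDenominator_eq_of_isRootTable (A := CartanMatrix.G₂) e he ![3, 1]
    (by decide) (by decide +kernel) (k := 0) (by decide) isRootTable_G2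
    (T := {1, 3, 4, 5, 6, 9}) (by decide +kernel)]
  simp only [SimpleLieType.superfactorial, Multiset.insert_eq_cons, Multiset.map_cons,
    Multiset.prod_cons, Multiset.map_singleton, Multiset.prod_singleton]
  norm_num
  ring

end Exceptional

/-! ### Coordinates for the classical types, and adjacent transpositions -/

/-- The standard basis vectors. -/
abbrev stdVec (a : ℕ) : ℕ →₀ ℂ := Finsupp.single a 1

/-- The vectors `ε_b - ε_a`, `a < b < n`. -/
def differenceRoots (n : ℕ) : Finset (ℕ →₀ ℂ) :=
  ((range n).sigma range).image fun p ↦ stdVec p.1 - stdVec p.2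

/-- The vectors `ε_b + ε_a`, `a < b < n`. -/
def sumRoots (n : ℕ) : Finset (ℕ →₀ ℂ) :=
  ((range n).sigma range).image fun p ↦ stdVec p.1 + stdVec p.2

lemma mem_differenceRoots {n : ℕ} {x : ℕ →₀ ℂ} :
    x ∈ differenceRoots n ↔ ∃ b a, a < b ∧ b < n ∧ x = stdVec b - stdVec a := by
  simp only [differenceRoots, Finset.mem_image, Finset.mem_sigma, Finset.mem_range, Sigma.exists]
  exact ⟨fun ⟨b, a, h, hx⟩ ↦ ⟨b, a, h.2, h.1, hx.symm⟩,
    fun ⟨b, a, h1, h2, hx⟩ ↦ ⟨b, a, ⟨h2, h1⟩, hx.symm⟩⟩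

lemma mem_sumRoots {n : ℕ} {x : ℕ →₀ ℂ} :
    x ∈ sumRoots n ↔ ∃ b a, a < b ∧ b < n ∧ x = stdVec b + stdVec a := by
  simp only [sumRoots, Finset.mem_image, Finset.mem_sigma, Finset.mem_range, Sigma.exists]
  exact ⟨fun ⟨b, a, h, hx⟩ ↦ ⟨b, a, h.2, h.1, hx.symm⟩,
    fun ⟨b, a, h1, h2, hx⟩ ↦ ⟨b, a, ⟨h2, h1⟩, hx.symm⟩⟩

lemma stdVec_sub_inj {a b c d : ℕ} (hab : a ≠ b)
    (h : stdVec b - stdVec a = stdVec d - stdVec c) : b = d ∧ a = c := by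
  have h1 := DFunLike.congr_fun h b
  have h2 := DFunLike.congr_fun h a
  simp only [Finsupp.sub_apply, Finsupp.single_apply] at h1 h2
  constructor
  · by_contra hbd
    have h3 : ¬ d = b := fun h ↦ hbd h.symm
    simp only [if_neg hab, if_neg h3] at h1
    split_ifs at h1 <;> norm_num at h1
  · by_contra hac
    have h3 : ¬ c = a := fun h ↦ hac h.symm
    simp only [if_neg hab.symm, if_neg h3] at h2
    split_ifs at h2 <;> norm_num at h2

lemma stdVec_add_inj {a b c d : ℕ} (hab : a < b) (hcd : c < d)
    (h : stdVec b + stdVec a = stdVec d + stdVec c) : b = d ∧ a = c := by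
  have h1 := DFunLike.congr_fun h b
  have h2 := DFunLike.congr_fun h a
  simp only [Finsupp.add_apply, Finsupp.single_apply] at h1 h2
  have h3 : b = d ∨ b = c := by
    by_contra! hbd
    simp [hab.ne, hbd.1.symm, hbd.2.symm] at h1
  have h4 : a = d ∨ a = c := by
    by_contra! had
    simp [hab.ne', had.1.symm, had.2.symm] at h2
  omega

lemma prod_differenceRoots (n : ℕ) (F : (ℕ →₀ ℂ) → ℂ) :
    ∏ x ∈ differenceRoots n, F x =
      ∏ b ∈ range n, ∏ a ∈ range b, F (stdVec b - stdVec a) := by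
  rw [differenceRoots, Finset.prod_image, Finset.prod_sigma]
  rintro ⟨b, a⟩ h ⟨d, c⟩ - hx
  have hab : a < b := by simpa using (Finset.mem_sigma.1 h).2
  obtain ⟨rfl, rfl⟩ := stdVec_sub_inj hab.ne hx
  rfl

lemma prod_sumRoots (n : ℕ) (F : (ℕ →₀ ℂ) → ℂ) :
    ∏ x ∈ sumRoots n, F x =
      ∏ b ∈ range n, ∏ a ∈ range b, F (stdVec b + stdVec a) := by
  rw [sumRoots, Finset.prod_image, Finset.prod_sigma]
  rintro ⟨b, a⟩ h ⟨d, c⟩ h' hx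
  have hab : a < b := by simpa using (Finset.mem_sigma.1 h).2
  have hcd : c < d := by simpa using (Finset.mem_sigma.1 h').2
  obtain ⟨rfl, rfl⟩ := stdVec_add_inj hab hcd hx
  rfl

lemma disjoint_differenceRoots_sumRoots (n : ℕ) :
    Disjoint (differenceRoots n) (sumRoots n) := by
  rw [Finset.disjoint_left]
  intro x hx hx'
  obtain ⟨b, a, hab, -, rfl⟩ := mem_differenceRoots.1 hx
  obtain ⟨d, c, -, -, h⟩ := mem_sumRoots.1 hx'
  have := DFunLike.congr_fun h a
  simp only [Finsupp.sub_apply, Finsupp.add_apply, Finsupp.single_apply, if_neg hab.ne'] at this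
  split_ifs at this <;> norm_num at this

/-- The coroot of `ε_{c + 1} - ε_c`. -/
def chainCoroot (c : ℕ) : Module.Dual ℂ (ℕ →₀ ℂ) := Finsupp.lapply (c + 1) - Finsupp.lapply c

lemma chainCoroot_apply (c : ℕ) (x : ℕ →₀ ℂ) : chainCoroot c x = x (c + 1) - x c := rfl

/-- The reflection in `ε_{c + 1} - ε_c` swaps `ε_{c + 1}` and `ε_c`. -/
lemma stdVec_chainReflection (c a : ℕ) :
    stdVec a - chainCoroot c (stdVec a) • (stdVec (c + 1) - stdVec c) =
      stdVec (Equiv.swap c (c + 1) a) := by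
  rw [chainCoroot_apply]
  rcases eq_or_ne a c with rfl | h1
  · simp
  · rcases eq_or_ne a (c + 1) with rfl | h2
    · simp
    · simp [h1, h2, Equiv.swap_apply_of_ne_of_ne]

lemma add_chainReflection (c : ℕ) (x y : ℕ →₀ ℂ) :
    (x + y) - chainCoroot c (x + y) • (stdVec (c + 1) - stdVec c) =
      (x - chainCoroot c x • (stdVec (c + 1) - stdVec c)) +
        (y - chainCoroot c y • (stdVec (c + 1) - stdVec c)) := by
  rw [map_add]
  module

lemma smul_chainReflection (c : ℕ) (t : ℂ) (x : ℕ →₀ ℂ) :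
    (t • x) - chainCoroot c (t • x) • (stdVec (c + 1) - stdVec c) =
      t • (x - chainCoroot c x • (stdVec (c + 1) - stdVec c)) := by
  rw [map_smul, smul_eq_mul]
  module

lemma stdVec_sub_chainReflection (c a b : ℕ) :
    (stdVec b - stdVec a) - chainCoroot c (stdVec b - stdVec a) • (stdVec (c + 1) - stdVec c) =
      stdVec (Equiv.swap c (c + 1) b) - stdVec (Equiv.swap c (c + 1) a) := by
  rw [← stdVec_chainReflection, ← stdVec_chainReflection, map_sub]
  module

lemma stdVec_add_chainReflection (c a b : ℕ) :
    (stdVec b + stdVec a) - chainCoroot c (stdVec b + stdVec a) • (stdVec (c + 1) - stdVec c) =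
      stdVec (Equiv.swap c (c + 1) b) + stdVec (Equiv.swap c (c + 1) a) := by
  rw [add_chainReflection, stdVec_chainReflection, stdVec_chainReflection]

/-- An adjacent transposition reverses the order of only one pair of indices, namely the excluded
one. -/
lemma chainReflection_mem_differenceRoots {n c : ℕ} (hc : c + 1 < n) {x : ℕ →₀ ℂ}
    (hx : x ∈ differenceRoots n) (hxc : x ≠ stdVec (c + 1) - stdVec c) :
    x - chainCoroot c x • (stdVec (c + 1) - stdVec c) ∈ differenceRoots n := by
  obtain ⟨b, a, hab, hb, rfl⟩ := mem_differenceRoots.1 hx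
  rw [stdVec_sub_chainReflection]
  have : ¬ (b = c + 1 ∧ a = c) := by
    rintro ⟨rfl, rfl⟩
    exact hxc rfl
  refine mem_differenceRoots.2 ⟨_, _, ?_, ?_, rfl⟩
  all_goals
    simp only [Equiv.swap_apply_def]
    split_ifs <;> omega

lemma chainReflection_mem_sumRoots {n c : ℕ} (hc : c + 1 < n) {x : ℕ →₀ ℂ}
    (hx : x ∈ sumRoots n) :
    x - chainCoroot c x • (stdVec (c + 1) - stdVec c) ∈ sumRoots n := by
  obtain ⟨b, a, hab, hb, rfl⟩ := mem_sumRoots.1 hx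
  rw [stdVec_add_chainReflection]
  have h1 : Equiv.swap c (c + 1) b < n := by
    simp only [Equiv.swap_apply_def]
    split_ifs <;> omega
  have h2 : Equiv.swap c (c + 1) a < n := by
    simp only [Equiv.swap_apply_def]
    split_ifs <;> omega
  rcases lt_or_gt_of_ne ((Equiv.swap c (c + 1)).injective.ne hab.ne) with h | h
  · exact mem_sumRoots.2 ⟨_, _, h, h1, rfl⟩
  · exact mem_sumRoots.2 ⟨_, _, h, h2, add_comm _ _⟩

lemma chainReflection_mem_smul {n c : ℕ} (hc : c + 1 < n) {t : ℂ} {x : ℕ →₀ ℂ}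
    (hx : x ∈ (range n).image fun b ↦ t • stdVec b) :
    x - chainCoroot c x • (stdVec (c + 1) - stdVec c) ∈
      (range n).image fun b ↦ t • stdVec b := by
  obtain ⟨b, hb, rfl⟩ := Finset.mem_image.1 hx
  rw [Finset.mem_range] at hb
  rw [smul_chainReflection, stdVec_chainReflection]
  refine Finset.mem_image_of_mem (fun b ↦ t • stdVec b) ?_
  rw [Finset.mem_range, Equiv.swap_apply_def]
  split_ifs <;> omega

section Induction

variable {n : ℕ} {S : Finset (ℕ →₀ ℂ)} {p : (ℕ →₀ ℂ) → Prop}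
  (hstep : ∀ c, c + 1 < n → ∀ x ∈ S, x ≠ stdVec (c + 1) - stdVec c → p x →
    p (x - chainCoroot c x • (stdVec (c + 1) - stdVec c)))

include hstep

/-- With `a` fixed, transpositions raise `b` one step at a time from `a + 1`. -/
lemma differenceRoots_induction (hS : differenceRoots n ⊆ S)
    (hsimple : ∀ c, c + 1 < n → p (stdVec (c + 1) - stdVec c)) :
    ∀ x ∈ differenceRoots n, p x := by
  intro x hx
  obtain ⟨b, a, hab, hb, rfl⟩ := mem_differenceRoots.1 hx
  clear hx
  induction b, hab using Nat.le_induction with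
  | base => exact hsimple a hb
  | succ b hab ih =>
    have h := hstep b hb (stdVec b - stdVec a)
      (hS (mem_differenceRoots.2 ⟨b, a, hab, by omega, rfl⟩))
      (fun h ↦ by have := (stdVec_sub_inj (by omega) h).1; omega) (ih (by omega))
    rwa [stdVec_sub_chainReflection, Equiv.swap_apply_left,
      Equiv.swap_apply_of_ne_of_ne (by omega) (by omega)] at h

lemma smul_stdVec_induction {t : ℂ} (hS : ∀ b < n, t • stdVec b ∈ S)
    (h0 : p (t • stdVec 0)) :
    ∀ b < n, p (t • stdVec b) := by
  intro b
  induction b with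
  | zero => exact fun _ ↦ h0
  | succ b ih =>
    intro hb
    have h := hstep b hb (t • stdVec b) (hS b (by omega)) (fun h ↦ by
      have := DFunLike.congr_fun h (b + 1)
      simp at this) (ih (by omega))
    rwa [smul_chainReflection, stdVec_chainReflection, Equiv.swap_apply_left] at h

/-- With `b` fixed, transpositions raise `a` from `0`. The base `ε_b + ε_0` is left as a hypothesis
since it needs the exceptional simple reflection, which depends on the type. -/
lemma sumRoots_induction (hS : sumRoots n ⊆ S)
    (h0 : ∀ b, 0 < b → b < n → p (stdVec b + stdVec 0)) :
    ∀ x ∈ sumRoots n, p x := by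
  intro x hx
  obtain ⟨b, a, hab, hb, rfl⟩ := mem_sumRoots.1 hx
  clear hx
  induction a with
  | zero => exact h0 b hab hb
  | succ a ih =>
    have h := hstep a (by omega) (stdVec b + stdVec a)
      (hS (mem_sumRoots.2 ⟨b, a, by omega, hb, rfl⟩)) (fun h ↦ by
        have := DFunLike.congr_fun h b
        simp only [Finsupp.add_apply, Finsupp.sub_apply, Finsupp.single_apply] at this
        simp [show a ≠ b by omega, show a + 1 ≠ b by omega] at this) (ih (by omega))
    rwa [stdVec_add_chainReflection, Equiv.swap_apply_left,
      Equiv.swap_apply_of_ne_of_ne (by omega) (by omega)] at h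

end Induction

lemma prod_range_sub {n : ℕ} (F : ℕ → ℂ) :
    ∏ a ∈ range n, F (n - a) = ∏ m ∈ Icc 1 n, F m := by
  refine Finset.prod_bij' (fun a _ ↦ n - a) (fun m _ ↦ n - m) ?_ ?_ ?_ ?_ ?_ <;>
    simp only [Finset.mem_range, Finset.mem_Icc] <;> intros <;> first | omega | trivial

lemma prod_Icc_mul_prod_range (n m : ℕ) (F : ℕ → ℂ) :
    (∏ k ∈ Icc 1 n, F k) * ∏ a ∈ range m, F (n + 1 + a) = ∏ k ∈ Icc 1 (n + m), F k := by
  induction m with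
  | zero => simp
  | succ m ih =>
    rw [Finset.prod_range_succ, ← mul_assoc, ih, ← add_assoc,
      Finset.prod_Icc_succ_top (by omega), add_right_comm]

/-! ### Type A -/

section TypeA

variable {ι M N : Type*} [Fintype ι] [AddCommGroup M] [Module ℂ M] [AddCommGroup N] [Module ℂ N]
  {P : RootPairing ι ℂ M N} [P.IsCrystallographic] [P.IsReduced] [P.IsRootSystem]
  [P.IsIrreducible] {b : P.Base} (q : ℂ)

lemma quantumWeylDenominator_A {r : ℕ} (hr : 1 ≤ r) (h : HasLieType b (.A r hr)) :
    quantumWeylDenominator b q = (SimpleLieType.A r hr).superfactorial q := by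
  obtain ⟨e, he⟩ := h
  rw [RootPairing.Base.quantumWeylDenominator_eq_prod (A := CartanMatrix.A r) e he (fun _ ↦ 1)
    (by simp) ?_ (k := ⟨0, hr⟩) (by simp) (fun i ↦ stdVec (i + 1) - stdVec i)
    (fun i ↦ chainCoroot i) ?_ (differenceRoots (r + 1)) ?_ ?_ ?_
    (Finsupp.linearCombination ℂ (fun a ↦ (a : ℂ))) ?_ q]
  -- `⟨ρ, ·⟩` becomes the form `ε_a ↦ a`, so the roots with larger index `b` contribute `[b]!`.
  · have h1 (b : ℕ) : ∏ a ∈ range b, qNumber q ((b : ℂ) - a) = qFactorial q b := by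
      rw [qFactorial, ← prod_range_sub fun a ↦ qNumber q a]
      refine Finset.prod_congr rfl fun a ha ↦ ?_
      rw [Nat.cast_sub (Finset.mem_range.1 ha).le]
    simp only [prod_differenceRoots, map_sub, Finsupp.linearCombination_single, one_smul, h1]
    rw [Finset.prod_range_succ', show qFactorial q 0 = 1 from rfl, mul_one]
    change _ = (((Multiset.range r).map fun i ↦ i + 1).map (qFactorial q)).prod
    rw [Multiset.map_map]
    rfl
  · intro i j
    have := CartanMatrix.A_isSymm r
    simp [this.apply j i]
  · intro i j
    simp only [chainCoroot_apply, Finsupp.sub_apply, Finsupp.single_apply, CartanMatrix.A,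
      Matrix.of_apply, Fin.ext_iff]
    split_ifs <;> first | omega | norm_num
  · exact fun i ↦ mem_differenceRoots.2 ⟨_, _, Nat.lt_succ_self _, by omega, rfl⟩
  · exact fun i x hx hxi ↦ chainReflection_mem_differenceRoots (by omega) hx hxi
  · intro p h1 h2
    exact differenceRoots_induction (fun c hc ↦ h2 ⟨c, by omega⟩) subset_rfl
      fun c hc ↦ h1 ⟨c, by omega⟩
  · intro i
    simp

end TypeA

/-! ### Types B, C and D -/

/-- The simple roots of type `B` (for `t = 1`) and `C` (for `t = 2`), the exceptional one first. -/
def simpleRootBC (t : ℂ) : ℕ → ℕ →₀ ℂ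
  | 0 => t • stdVec 0
  | c + 1 => stdVec (c + 1) - stdVec c

/-- The simple coroots of type `B` (for `t = 1`) and `C` (for `t = 2`). -/
def simpleCorootBC (t : ℂ) : ℕ → Module.Dual ℂ (ℕ →₀ ℂ)
  | 0 => (2 / t) • Finsupp.lapply 0
  | c + 1 => chainCoroot c

/-- The positive roots of type `B` (for `t = 1`) and `C` (for `t = 2`). -/
def positiveRootsBC (t : ℂ) (r : ℕ) : Finset (ℕ →₀ ℂ) :=
  (differenceRoots r ∪ sumRoots r) ∪ (range r).image fun b ↦ t • stdVec b

/-- The simple roots of type `D`, those of the fork first. -/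
def simpleRootD : ℕ → ℕ →₀ ℂ
  | 0 => stdVec 1 + stdVec 0
  | c + 1 => stdVec (c + 1) - stdVec c

/-- The simple coroots of type `D`. -/
def simpleCorootD : ℕ → Module.Dual ℂ (ℕ →₀ ℂ)
  | 0 => Finsupp.lapply 1 + Finsupp.lapply 0
  | c + 1 => chainCoroot c

lemma prod_positiveRootsBC {t : ℂ} (ht : t ≠ 0) (r : ℕ) (F : (ℕ →₀ ℂ) → ℂ) :
    ∏ x ∈ positiveRootsBC t r, F x = ∏ b ∈ range r, F (t • stdVec b) *
      ∏ a ∈ range b, F (stdVec b - stdVec a) * F (stdVec b + stdVec a) := by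
  rw [positiveRootsBC, Finset.prod_union, Finset.prod_union (disjoint_differenceRoots_sumRoots r),
    prod_differenceRoots, prod_sumRoots, Finset.prod_image, ← Finset.prod_mul_distrib,
    ← Finset.prod_mul_distrib]
  · refine Finset.prod_congr rfl fun b _ ↦ ?_
    rw [Finset.prod_mul_distrib, mul_comm]
  · intro b _ c _ h
    by_contra hbc
    have := DFunLike.congr_fun h b
    simp [ht, Ne.symm hbc] at this
  · rw [Finset.disjoint_right]
    intro x hx
    obtain ⟨c, -, rfl⟩ := Finset.mem_image.1 hx
    rw [Finset.mem_union, mem_differenceRoots, mem_sumRoots]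
    rintro (⟨b, a, hab, -, h⟩ | ⟨b, a, hab, -, h⟩)
    all_goals
      have h1 := DFunLike.congr_fun h a
      have h2 := DFunLike.congr_fun h b
      rcases eq_or_ne c a with rfl | hca
      · simp [hab.ne] at h2
      · simp [hab.ne', hca] at h1

/-- The reflection changes the sign of `ε_0`: it exchanges `ε_b - ε_0` with `ε_b + ε_0` and fixes
the positive roots not involving `ε_0`. -/
lemma signReflection_mem {t : ℂ} (ht : t ≠ 0) {r : ℕ} {x : ℕ →₀ ℂ}
    (hx : x ∈ positiveRootsBC t r) (hx0 : x ≠ simpleRootBC t 0) :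
    x - simpleCorootBC t 0 x • simpleRootBC t 0 ∈ positiveRootsBC t r := by
  have key (x : ℕ →₀ ℂ) :
      x - simpleCorootBC t 0 x • simpleRootBC t 0 = x - (2 * x 0) • stdVec 0 := by
    simp only [simpleCorootBC, simpleRootBC, LinearMap.smul_apply, Finsupp.lapply_apply, smul_smul,
      smul_eq_mul]
    congr 2
    field_simp
  have hfix (h : x 0 = 0) : x - simpleCorootBC t 0 x • simpleRootBC t 0 = x := by
    rw [key, h, mul_zero, zero_smul, sub_zero]
  have hx' := hx
  simp only [positiveRootsBC, Finset.mem_union, mem_differenceRoots, mem_sumRoots] at hx'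
  obtain (⟨b, a, hab, hb, rfl⟩ | ⟨b, a, hab, hb, rfl⟩) | hx' := hx'
  · rcases eq_or_ne a 0 with rfl | ha
    · rw [key]
      simp only [positiveRootsBC, Finset.mem_union, mem_sumRoots]
      refine Or.inl (Or.inr ⟨b, 0, hab, hb, ?_⟩)
      simp only [Finsupp.sub_apply, Finsupp.single_apply, if_neg hab.ne', if_true]
      module
    · rwa [hfix (by simp [ha, show b ≠ 0 by omega])]
  · rcases eq_or_ne a 0 with rfl | ha
    · rw [key]
      simp only [positiveRootsBC, Finset.mem_union, mem_differenceRoots]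
      refine Or.inl (Or.inl ⟨b, 0, hab, hb, ?_⟩)
      simp only [Finsupp.add_apply, Finsupp.single_apply, if_neg hab.ne', if_true]
      module
    · rwa [hfix (by simp [ha, show b ≠ 0 by omega])]
  · obtain ⟨b, -, rfl⟩ := Finset.mem_image.1 hx'
    have hb : b ≠ 0 := by
      rintro rfl
      exact hx0 rfl
    rwa [hfix (by simp [hb])]

/-- The reflection sends `ε_0` to `-ε_1` and `ε_1` to `-ε_0`. For `a ≤ 1 < b` it exchanges `ε_b -
ε_a` with `ε_b + ε_{1-a}`, and it fixes the other positive roots apart from its own. -/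
lemma forkReflection_mem {r : ℕ} {x : ℕ →₀ ℂ}
    (hx : x ∈ differenceRoots r ∪ sumRoots r) (hx0 : x ≠ simpleRootD 0) :
    x - simpleCorootD 0 x • simpleRootD 0 ∈ differenceRoots r ∪ sumRoots r := by
  have key (x : ℕ →₀ ℂ) : x - simpleCorootD 0 x • simpleRootD 0 =
      x - (x 1 + x 0) • (stdVec 1 + stdVec 0) := rfl
  have hfix (h : x 1 + x 0 = 0) : x - simpleCorootD 0 x • simpleRootD 0 = x := by
    rw [key, h, zero_smul, sub_zero]
  have hx' := hx
  simp only [Finset.mem_union, mem_differenceRoots, mem_sumRoots] at hx'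
  obtain ⟨b, a, hab, hb, rfl⟩ | ⟨b, a, hab, hb, rfl⟩ := hx'
  · rcases (show 2 ≤ a ∨ (a = 0 ∧ b = 1) ∨ (a ≤ 1 ∧ 2 ≤ b) by omega) with ha | ⟨rfl, rfl⟩ | ⟨ha, h2⟩
    · rwa [hfix (by simp [show a ≠ 0 by omega, show a ≠ 1 by omega, show b ≠ 0 by omega,
        show b ≠ 1 by omega])]
    · rwa [hfix (by simp)]
    · rw [key]
      refine Finset.mem_union_right _ (mem_sumRoots.2 ⟨b, 1 - a, by omega, hb, ?_⟩)
      interval_cases a <;>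
        simp [show b ≠ 0 by omega, show b ≠ 1 by omega] <;> abel
  · rcases (show 2 ≤ a ∨ (a = 0 ∧ b = 1) ∨ (a ≤ 1 ∧ 2 ≤ b) by omega) with ha | ⟨rfl, rfl⟩ | ⟨ha, h2⟩
    · rwa [hfix (by simp [show a ≠ 0 by omega, show a ≠ 1 by omega, show b ≠ 0 by omega,
        show b ≠ 1 by omega])]
    · exact absurd rfl hx0
    · rw [key]
      refine Finset.mem_union_left _ (mem_differenceRoots.2 ⟨b, 1 - a, by omega, hb, ?_⟩)
      interval_cases a <;>
        simp only [Finsupp.add_apply, Finsupp.single_apply, if_neg (show b ≠ 0 by omega),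
          if_neg (show b ≠ 1 by omega), if_true, one_ne_zero, zero_ne_one, if_false] <;>
        module

section Classical

variable {ι M N : Type*} [Fintype ι] [AddCommGroup M] [Module ℂ M] [AddCommGroup N] [Module ℂ N]
  {P : RootPairing ι ℂ M N} [P.IsCrystallographic] [P.IsReduced] [P.IsRootSystem]
  [P.IsIrreducible] {b : P.Base} (q : ℂ)

/-- The function `f` gives the values of `⟨ρ, ·⟩` on the `ε_a`. Nodes are reversed so that the
exceptional one has index `0`, making the model uniform in `r`. -/
lemma quantumWeylDenominator_BC {r : ℕ} {A : Matrix (Fin r) (Fin r) ℤ} (e : b.support ≃ Fin r)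
    (he : ∀ i j, b.cartanMatrix i j = A (e i).rev (e j).rev)
    (d : ℕ → ℕ) (hd : ∀ i, 0 < d i)
    (hA : ∀ i j : Fin r, A i j * d j = A j i * d i) {k : Fin r} (hk : ∀ i, d i ≤ d k)
    {t : ℂ} (ht : t ≠ 0)
    (hwv : ∀ i j : Fin r, simpleCorootBC t j (simpleRootBC t i) = A i j)
    (f : ℕ → ℂ) (hf0 : t * f 0 = (d 0 : ℂ) / d k)
    (hf : ∀ i, f (i + 1) - f i = (d (i + 1) : ℂ) / d k) :
    quantumWeylDenominator b q = ∏ b ∈ range r, qNumber q (t * f b) *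
      ∏ a ∈ range b, qNumber q (f b - f a) * qNumber q (f b + f a) := by
  have hr : 0 < r := k.pos
  rw [RootPairing.Base.quantumWeylDenominator_eq_prod (A := A) (e.trans Fin.revPerm) he
    (fun i ↦ d i) (fun i ↦ hd i) hA (k := k) (fun i ↦ hk i) (fun i ↦ simpleRootBC t i)
    (fun i ↦ simpleCorootBC t i) hwv (positiveRootsBC t r) ?_ ?_ ?_
    (Finsupp.linearCombination ℂ f) ?_ q]
  · simp only [prod_positiveRootsBC ht, map_sub, map_add, map_smul,
      Finsupp.linearCombination_single, smul_eq_mul, one_mul]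
  · rintro ⟨_ | i, hi⟩
    · exact Finset.mem_union_right _
        (Finset.mem_image_of_mem (fun b ↦ t • stdVec b) (Finset.mem_range.2 hr))
    · exact Finset.mem_union_left _ (Finset.mem_union_left _
        (mem_differenceRoots.2 ⟨_, _, Nat.lt_succ_self i, hi, rfl⟩))
  · rintro ⟨_ | i, hi⟩ x hx hxi
    · exact signReflection_mem ht hx hxi
    · simp only [positiveRootsBC, Finset.mem_union] at hx ⊢
      exact hx.imp (Or.imp (chainReflection_mem_differenceRoots hi · hxi)
        (chainReflection_mem_sumRoots hi)) (chainReflection_mem_smul hi)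
  · intro p h1 h2
    have hstep (c : ℕ) (hc : c + 1 < r) := h2 ⟨c + 1, hc⟩
    have hdiff := differenceRoots_induction hstep
      (Finset.subset_union_left.trans Finset.subset_union_left) fun c hc ↦ h1 ⟨c + 1, hc⟩
    have hsmul := smul_stdVec_induction (t := t) hstep (fun b hb ↦ Finset.mem_union_right _
      (Finset.mem_image_of_mem (fun b ↦ t • stdVec b) (Finset.mem_range.2 hb))) (h1 ⟨0, hr⟩)
    have hsum := sumRoots_induction hstep
      (Finset.subset_union_right.trans Finset.subset_union_left) fun b hb0 hb ↦ by
        have hmem := mem_differenceRoots.2 ⟨b, 0, hb0, hb, rfl⟩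
        have h := h2 ⟨0, hr⟩ _ (Finset.mem_union_left _ (Finset.mem_union_left _ hmem)) (fun h ↦ by
          have := DFunLike.congr_fun h b
          simp [simpleRootBC, hb0.ne'] at this) (hdiff _ hmem)
        convert h using 1
        simp only [simpleCorootBC, simpleRootBC, LinearMap.smul_apply, Finsupp.lapply_apply,
          smul_smul, smul_eq_mul, Finsupp.sub_apply, Finsupp.single_apply, if_neg hb0.ne', if_true]
        rw [show 2 / t * ((0 : ℂ) - 1) * t = -2 by simp [ht]]
        module
    intro x hx
    simp only [positiveRootsBC, Finset.mem_union, Finset.mem_image, Finset.mem_range] at hx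
    obtain (hx | hx) | ⟨b, hb, rfl⟩ := hx
    exacts [hdiff x hx, hsum x hx, hsmul b hb]
  · rintro ⟨_ | i, hi⟩
    · simpa [simpleRootBC] using hf0
    · simpa [simpleRootBC] using hf i

lemma quantumWeylDenominator_B {r : ℕ} (hr : 2 ≤ r) (h : HasLieType b (.B r hr)) :
    quantumWeylDenominator b q = (SimpleLieType.B r hr).superfactorial q := by
  obtain ⟨e, he⟩ := h
  change b.support ≃ Fin r at e
  rw [quantumWeylDenominator_BC (A := (CartanMatrix.B r).submatrix Fin.rev Fin.rev) q e ?_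
    (fun i ↦ if i = 0 then 1 else 2) ?_ ?_ (k := ⟨1, hr⟩) ?_ one_ne_zero ?_ (fun a ↦ a + 1 / 2)
    (by simp) (by intro i; simp)]
  · change _ = (((Multiset.range r).map fun i ↦ 2 * i + 1).map (qFactorialB q)).prod
    rw [Multiset.map_map]
    -- For `s = 2b + 1`, the short root gives `[s/2]`, the differences give `[1], …, [b]` and the
    -- sums give `[b+1], …, [2b]`.
    refine Finset.prod_congr rfl fun b _ ↦ ?_
    rw [Function.comp_apply, qFactorialB, Nat.add_sub_cancel, two_mul b,
      ← prod_Icc_mul_prod_range, ← prod_range_sub, ← Finset.prod_mul_distrib]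
    congr 1
    · congr 1
      push_cast
      ring
    · refine Finset.prod_congr rfl fun a ha ↦ ?_
      rw [Nat.cast_sub (Finset.mem_range.1 ha).le]
      congr 2 <;>
      · push_cast
        ring
  · intro i j
    simp [he]
    rfl
  · intro i
    split_ifs <;> simp
  · intro i j
    simp only [CartanMatrix.B, Matrix.submatrix_apply, Matrix.of_apply, Fin.ext_iff, Fin.val_rev]
    split_ifs <;> omega
  · intro i
    simp only [one_ne_zero, if_false]
    split_ifs <;> simp
  · rintro ⟨_ | i, hi⟩ ⟨_ | j, hj⟩ <;>
      simp only [simpleRootBC, simpleCorootBC, chainCoroot_apply, Finsupp.sub_apply,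
        Finsupp.single_apply, CartanMatrix.B, Matrix.submatrix_apply, Matrix.of_apply, Fin.ext_iff,
        Fin.val_rev, LinearMap.smul_apply, Finsupp.lapply_apply, Finsupp.smul_apply, smul_eq_mul] <;>
      split_ifs <;> first | omega | contradiction | norm_num

/-- The three factors match the long root, the differences and the sums. The hypothesis `hq` serves
only `b = 0`, where the convention `1` must agree with the contribution `[1]` of the long root. -/
lemma qFactorialC_two_mul_add_one {q : ℂ} (hq : qNumber q 1 = 1) (b : ℕ) :
    qFactorialC q (2 * b + 1) = qNumber q ((b : ℂ) + 1) *
      ((∏ k ∈ Icc 1 b, qNumber q ((k : ℂ) / 2)) *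
        ∏ a ∈ range b, qNumber q (((b + 1 + 1 + a : ℕ) : ℂ) / 2)) := by
  rcases Nat.eq_zero_or_pos b with rfl | hb
  · simp [qFactorialC, hq]
  have hmid : (2 * b + 1 + 1) / 2 = b + 1 := by omega
  rw [qFactorialC, if_neg (by omega), hmid, show 2 * b + 1 = b + 1 + b by ring,
    ← prod_Icc_mul_prod_range, Finset.prod_Icc_succ_top (by omega), if_pos rfl]
  have h1 : ∏ n ∈ Icc 1 b, (if n = b + 1 then qNumber q n else qNumber q ((n : ℂ) / 2)) =
      ∏ k ∈ Icc 1 b, qNumber q ((k : ℂ) / 2) :=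
    Finset.prod_congr rfl fun n hn ↦ if_neg (by have := (Finset.mem_Icc.1 hn).2; omega)
  have h2 : ∏ a ∈ range b, (if b + 1 + 1 + a = b + 1 then qNumber q ((b + 1 + 1 + a : ℕ) : ℂ)
      else qNumber q (((b + 1 + 1 + a : ℕ) : ℂ) / 2)) =
      ∏ a ∈ range b, qNumber q (((b + 1 + 1 + a : ℕ) : ℂ) / 2) :=
    Finset.prod_congr rfl fun a _ ↦ if_neg (by omega)
  rw [h1, h2]
  push_cast
  ring

lemma quantumWeylDenominator_C {r : ℕ} (hr : 2 ≤ r) (h : HasLieType b (.C r hr))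
    (hq : qNumber q 1 = 1) :
    quantumWeylDenominator b q = (SimpleLieType.C r hr).superfactorial q := by
  obtain ⟨e, he⟩ := h
  change b.support ≃ Fin r at e
  rw [quantumWeylDenominator_BC (A := (CartanMatrix.C r).submatrix Fin.rev Fin.rev) q e ?_
    (fun i ↦ if i = 0 then 2 else 1) ?_ ?_ (k := ⟨0, by omega⟩) ?_ two_ne_zero ?_
    (fun a ↦ ((a : ℂ) + 1) / 2) (by simp) (by intro i; simp; ring)]
  · change _ = (((Multiset.range r).map fun i ↦ 2 * i + 1).map (qFactorialC q)).prod
    rw [Multiset.map_map]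
    refine Finset.prod_congr rfl fun b _ ↦ ?_
    rw [Function.comp_apply, qFactorialC_two_mul_add_one hq,
      ← prod_range_sub fun k ↦ qNumber q ((k : ℂ) / 2), ← Finset.prod_mul_distrib]
    congr 1
    · congr 1
      ring
    · refine Finset.prod_congr rfl fun a ha ↦ ?_
      rw [Nat.cast_sub (Finset.mem_range.1 ha).le]
      congr 2
      · ring
      · push_cast
        ring
  · intro i j
    simp [he]
    rfl
  · intro i
    split_ifs <;> simp
  · intro i j
    simp only [CartanMatrix.C, Matrix.submatrix_apply, Matrix.of_apply, Fin.ext_iff, Fin.val_rev]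
    split_ifs <;> omega
  · intro i
    simp only [if_true]
    split_ifs <;> simp
  · rintro ⟨_ | i, hi⟩ ⟨_ | j, hj⟩ <;>
      simp only [simpleRootBC, simpleCorootBC, chainCoroot_apply, Finsupp.sub_apply,
        Finsupp.single_apply, CartanMatrix.C, Matrix.submatrix_apply, Matrix.of_apply, Fin.ext_iff,
        Fin.val_rev, LinearMap.smul_apply, Finsupp.lapply_apply, Finsupp.smul_apply, smul_eq_mul] <;>
      split_ifs <;> first | omega | contradiction | norm_num

/-- After reversal the fork consists of nodes `0` and `1`, both joined to `2`; the model pairings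
are brought to this same formula. -/
lemma cartanMatrix_D_rev {r : ℕ} (hr : 3 ≤ r) (i j : Fin r) :
    CartanMatrix.D r i.rev j.rev = if (i : ℕ) = j then 2 else
      if (i : ℕ) + 1 = j ∧ 1 ≤ (i : ℕ) ∨ (j : ℕ) + 1 = i ∧ 1 ≤ (j : ℕ) ∨
        (i : ℕ) = 0 ∧ (j : ℕ) = 2 ∨ (j : ℕ) = 0 ∧ (i : ℕ) = 2 then -1 else 0 := by
  simp only [CartanMatrix.D, Matrix.of_apply, Fin.ext_iff, Fin.val_rev]
  split_ifs <;> omega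

lemma simpleCorootD_simpleRootD (i j : ℕ) :
    simpleCorootD j (simpleRootD i) = ((if i = j then 2 else
      if i + 1 = j ∧ 1 ≤ i ∨ j + 1 = i ∧ 1 ≤ j ∨ i = 0 ∧ j = 2 ∨ j = 0 ∧ i = 2 then -1 else 0 :
        ℤ) : ℂ) := by
  rcases i with _ | i <;> rcases j with _ | j <;>
    simp only [simpleRootD, simpleCorootD, chainCoroot_apply, Finsupp.sub_apply,
      Finsupp.add_apply, Finsupp.single_apply, LinearMap.add_apply, Finsupp.lapply_apply] <;>
    split_ifs <;> first | omega | grind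

lemma quantumWeylDenominator_D {r : ℕ} (hr : 3 ≤ r) (h : HasLieType b (.D r hr)) :
    quantumWeylDenominator b q = (SimpleLieType.D r hr).superfactorial q := by
  obtain ⟨e, he⟩ := h
  change b.support ≃ Fin r at e
  rw [RootPairing.Base.quantumWeylDenominator_eq_prod
    (A := (CartanMatrix.D r).submatrix Fin.rev Fin.rev) (e.trans Fin.revPerm) ?_
    (fun i ↦ 1) (by simp) ?_ (k := ⟨0, by omega⟩) (by simp) (fun i ↦ simpleRootD i)
    (fun i ↦ simpleCorootD i) ?_ (differenceRoots r ∪ sumRoots r) ?_ ?_ ?_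
    (Finsupp.linearCombination ℂ (fun a ↦ (a : ℂ))) ?_ q]
  · obtain ⟨m, rfl⟩ : ∃ m, r = m + 1 := ⟨r - 1, by omega⟩
    change _ = (((m + 1 - 1) ::ₘ
      (Multiset.range (m + 1 - 1)).map fun i ↦ 2 * i + 1).map (qFactorial q)).prod
    rw [Nat.add_sub_cancel, Multiset.map_cons, Multiset.prod_cons, Multiset.map_map,
      Finset.prod_union (disjoint_differenceRoots_sumRoots _), prod_differenceRoots, prod_sumRoots,
      ← Finset.prod_mul_distrib, Finset.prod_range_succ']
    simp only [map_sub, map_add, Finsupp.linearCombination_single, one_smul, Finset.range_zero,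
      Finset.prod_empty, mul_one]
    have h1 : qFactorial q m = ∏ i ∈ range m, qNumber q ((i + 1 : ℕ) : ℂ) := by
      have := prod_Icc_mul_prod_range 0 m fun n ↦ qNumber q (n : ℂ)
      rw [Finset.Icc_eq_empty (by omega), Finset.prod_empty, one_mul, zero_add, zero_add] at this
      rw [qFactorial, ← this]
      exact Finset.prod_congr rfl fun i _ ↦ by rw [add_comm]
    rw [h1]
    change _ = _ * ∏ i ∈ range m, qFactorial q (2 * i + 1)
    rw [← Finset.prod_mul_distrib]
    refine Finset.prod_congr rfl fun i _ ↦ ?_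
    -- For larger index `i + 1` the differences give `[1], …, [i+1]` and the sums `[i+1], …,
    -- [2i+1]`. The repeated `[i+1]`, from `a = 0`, goes into the factorial of the exponent `r - 1`.
    rw [qFactorial, show 2 * i + 1 = i + 1 + i by ring, ← prod_Icc_mul_prod_range,
      ← prod_range_sub, Finset.prod_range_succ' fun a ↦ qNumber q (((i + 1 : ℕ) : ℂ) + a)]
    rw [Nat.cast_zero, add_zero, ← mul_assoc, mul_comm]
    congr 2
    · refine Finset.prod_congr rfl fun a ha ↦ ?_
      rw [Nat.cast_sub (Finset.mem_range.1 ha).le]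
    · refine Finset.prod_congr rfl fun a _ ↦ ?_
      congr 1
      push_cast
      ring
  · intro i j
    simp [he]
    rfl
  · intro i j
    have := CartanMatrix.D_isSymm r
    simp [this.apply j.rev i.rev]
  · intro i j
    rw [Matrix.submatrix_apply, cartanMatrix_D_rev hr, simpleCorootD_simpleRootD]
  · rintro ⟨_ | i, hi⟩
    · exact Finset.mem_union_right _ (mem_sumRoots.2 ⟨1, 0, one_pos, by omega, rfl⟩)
    · exact Finset.mem_union_left _ (mem_differenceRoots.2 ⟨_, _, Nat.lt_succ_self i, hi, rfl⟩)
  · rintro ⟨_ | i, hi⟩ x hx hxi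
    · exact forkReflection_mem hx hxi
    · rw [Finset.mem_union] at hx ⊢
      exact hx.imp (chainReflection_mem_differenceRoots hi · hxi) (chainReflection_mem_sumRoots hi)
  · intro p h1 h2
    have hstep (c : ℕ) (hc : c + 1 < r) := h2 ⟨c + 1, hc⟩
    have hdiff := differenceRoots_induction hstep Finset.subset_union_left
      fun c hc ↦ h1 ⟨c + 1, hc⟩
    have hsum := sumRoots_induction hstep Finset.subset_union_right fun b hb0 hb ↦ by
      -- For `b = 1` this is the fork's simple root; otherwise its reflection maps `ε_b - ε_1` to
      -- `ε_b + ε_0`.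
      obtain rfl | hb1 := eq_or_ne b 1
      · exact h1 ⟨0, by omega⟩
      have hmem := mem_differenceRoots.2 ⟨b, 1, by omega, hb, rfl⟩
      have h := h2 ⟨0, by omega⟩ _ (Finset.mem_union_left _ hmem) (fun h ↦ by
        have := DFunLike.congr_fun h b
        simp [simpleRootD, hb0.ne, hb1.symm] at this) (hdiff _ hmem)
      convert h using 1
      simp only [simpleCorootD, simpleRootD, LinearMap.add_apply, Finsupp.lapply_apply,
        Finsupp.sub_apply, Finsupp.single_apply, if_neg hb0.ne', if_neg hb1]
      simp
      abel
    intro x hx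
    exact (Finset.mem_union.1 hx).elim (hdiff x) (hsum x)
  · rintro ⟨_ | i, hi⟩ <;> simp [simpleRootD]

end Classical

/-! ### Admissibility of the level values of `q` -/

lemma qNumber_one {q : ℂ} (hq : q ≠ 0) (hq2 : q ^ 2 ≠ 1) : qNumber q 1 = 1 := by
  rw [qNumber, Complex.cpow_one, Complex.cpow_neg_one]
  refine div_self fun h ↦ hq2 ?_
  rw [sub_eq_zero] at h
  rw [pow_two]
  nth_rw 2 [h]
  exact mul_inv_cancel₀ hq

lemma levelParameter_ne_zero (g : ℤ) (k : ℕ) : levelParameter g k ≠ 0 := Complex.exp_ne_zero _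

lemma levelParameter_sq_ne_one {g : ℤ} (hg : 2 ≤ g) (k : ℕ) : levelParameter g k ^ 2 ≠ 1 := by
  intro h
  rw [levelParameter, ← Complex.exp_nat_mul, Complex.exp_eq_one_iff] at h
  obtain ⟨n, hn⟩ := h
  have hgk : ((g : ℂ) + (k : ℂ)) ≠ 0 := by
    have : g + (k : ℤ) ≠ 0 := by omega
    exact_mod_cast this
  -- `q² = exp(2πi / (g + k))` equals `1` only if `g + k` divides `1`.
  have h1 : n * (g + k) = 1 := by
    have h2 : (Real.pi : ℂ) ≠ 0 := by exact_mod_cast Real.pi_ne_zero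
    have h3 : (n : ℂ) * (g + k) = 1 := by
      rw [mul_div_assoc', div_eq_iff hgk] at hn
      have h4 : 2 * (Real.pi : ℂ) * Complex.I ≠ 0 :=
        mul_ne_zero (mul_ne_zero two_ne_zero h2) Complex.I_ne_zero
      apply mul_left_cancel₀ h4
      push_cast at hn
      linear_combination -hn
    exact_mod_cast h3
  have h2 := Int.le_of_dvd one_pos (Dvd.intro_left n h1)
  omega

section DualCoxeter

variable {ι M N : Type*} [Fintype ι] [AddCommGroup M] [Module ℂ M] [AddCommGroup N] [Module ℂ N]
  {P : RootPairing ι ℂ M N} [P.IsCrystallographic] [P.IsReduced] {b : P.Base}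

/-- The coroot of a positive root is positive. -/
lemma RootPairing.Base.IsPos.flip {i : ι} (hi : b.IsPos i) : b.flip.IsPos i := by
  refine hi.induction_on_reflect (p := fun i ↦ b.IsPos i → b.flip.IsPos i)
    (fun i h _ ↦ isPos_of_mem_support (b := b.flip) h) ?_ hi
  intro i j hi hj hpos
  by_cases hij : P.reflectionPerm j i = j
  · rw [hij]
    exact isPos_of_mem_support (b := b.flip) hj
  have hi' : b.IsPos i := by simpa using hpos.reflectionPerm hj hij
  refine (hi hi').reflectionPerm (b := b.flip) hj ?_
  rintro rfl
  exact not_isPos_reflectionPerm_self hi' hpos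

/-- A highest root is at least as high as a simple root, hence positive; its coroot is then positive
too, so has height at least `1`. -/
lemma two_le_dualCoxeterNumber {θ : ι} (hθ : IsHighestRoot b θ) : 2 ≤ dualCoxeterNumber b θ := by
  have : Nonempty ι := ⟨θ⟩
  obtain ⟨i, hi⟩ := b.support_nonempty
  have hpos : b.IsPos θ := by
    have h1 := hθ i
    rw [RootPairing.Base.height_one_of_mem_support hi] at h1
    rw [RootPairing.Base.isPos_iff]
    omega
  have h2 := b.flip.isPos_iff.1 hpos.flip
  rw [dualCoxeterNumber]
  omega

end DualCoxeter

/-! ### All types together -/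

theorem quantumWeylDenominator_eq_superfactorial
    {ι M N : Type*} [Fintype ι] [AddCommGroup M] [Module ℂ M] [AddCommGroup N] [Module ℂ N]
    {P : RootPairing ι ℂ M N} [P.IsCrystallographic] [P.IsReduced] [P.IsRootSystem]
    [P.IsIrreducible] {b : P.Base} {G : SimpleLieType} (hG : HasLieType b G)
    {q : ℂ} (hq : q ≠ 0) (hq2 : q ^ 2 ≠ 1) :
    quantumWeylDenominator b q = G.superfactorial q := by
  cases G with
  | A r hr => exact quantumWeylDenominator_A q hr hG
  | B r hr => exact quantumWeylDenominator_B q hr hG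
  | C r hr => exact quantumWeylDenominator_C q hr hG (qNumber_one hq hq2)
  | D r hr => exact quantumWeylDenominator_D q hr hG
  | E6 => exact quantumWeylDenominator_E6 q hG
  | E7 => exact quantumWeylDenominator_E7 q hG
  | E8 => exact quantumWeylDenominator_E8 q hG
  | F4 => exact quantumWeylDenominator_F4 q hG
  | G2 => exact quantumWeylDenominator_G2 q hG

end

theorem mainTheorem2 (G : SimpleLieType)
    {L : Type*} [LieRing L] [LieAlgebra ℂ L] [FiniteDimensional ℂ L] [LieAlgebra.IsSimple ℂ L]
    (H : LieSubalgebra ℂ L) [H.IsCartanSubalgebra]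
    (b : (LieAlgebra.IsKilling.rootSystem H).Base) (hG : HasLieType b G) :
    (∀ θ, IsHighestRoot b θ → ∀ k : ℕ,
      quantumWeylDenominator b (levelParameter (dualCoxeterNumber b θ) k) =
        G.superfactorial (levelParameter (dualCoxeterNumber b θ) k)) ∧
    (∀ q : ℂ, q ≠ 0 → q ^ 2 ≠ 1 → quantumWeylDenominator b q = G.superfactorial q) :=
  ⟨fun _ hθ k ↦ quantumWeylDenominator_eq_superfactorial hG (levelParameter_ne_zero _ k)
    (levelParameter_sq_ne_one (two_le_dualCoxeterNumber hθ) k),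
    fun _ hq hq2 ↦ quantumWeylDenominator_eq_superfactorial hG hq hq2⟩
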